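/- Let $m,n\ge 0$ be integers and let $K$ be a field of characteristic zero with a finite set $\Delta=\{\delta_1,\dots,\delta_m\}$ of pairwise commuting derivations. Assume that $K$ is differentially closed: every finite system of differential polynomial equations $f_1=\dots=f_r=0$ together with an inequation $g\neq 0$, in finitely many differential indeterminates and with coefficients in $K$, that has a solution in some differential field extension of $K$ has a solution in $K$. Let $K[\Delta]$ be the ring of linear differential operators over $K$, i.e. the free left $K$-module on the monomials $\delta_1^{e_1}\cdots\delta_m^{e_m}$ with multiplication determined by $\delta_i\delta_j=\delta_j\delta_i$ and $\delta_i a=a\delta_i+\delta_i(a)$ for $a\in K$. Let $\mathcal L_n=K[\Delta]^n$ be the free left $K[\Delta]$-module of linear differential functions on $K^n$, where $\xi=(\xi_1,\dots,\xi_n)\in\mathcal L_n$ takes at $x=(x_1,\dots,x_n)\in K^n$ the value $\xi(x)=\xi_1x_1+\dots+\xi_nx_n$. For a differential submodule (i.e. $K[\Delta]$-submodule) $N\subseteq\mathcal L_n$ and a subset $X\subseteq K^n$ put $$V(N)=\{x\in K^n\mid \xi(x)=0 \text{ for all } \xi\in N\},\qquad I(X)=\{\xi\in\mathcal L_n\mid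 \xi(x)=0\text{ for all }x\in X\},$$ and call the sets of the form $V(N)$ linear differential spaces. Then $N=I(V(N))$ for every differential submodule $N\subseteq\mathcal L_n$. Consequently $N\mapsto V(N)$ is an inclusion-reversing bijection from the set of differential submodules of $\mathcal L_n$ onto the set of linear differential spaces in $K^n$, with inverse $X\mapsto I(X)$, and $N\subseteq N'$ if and only if $V(N')\subseteq V(N)$. -/

import Mathlib

universe u v

/-- A differential ring structure: `m` pairwise commuting derivations on `K`. -/
class CommutingDerivations (m : ℕ) (K : Type u) [CommRing K] where
  /-- The derivations `δ₁, …, δₘ`. -/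
  der : Fin m → Derivation ℤ K K
  der_comm : ∀ (i j : Fin m) (x : K), der i (der j x) = der j (der i x)

/-- A differential module over the differential ring `K`: a `K`-module with commuting additive
operators `δ₁, …, δₘ` satisfying `δᵢ (a • x) = δᵢ(a) • x + a • δᵢ(x)`. -/
class DifferentialModule (m : ℕ) (K : Type u) [CommRing K] [CommutingDerivations m K]
    (A : Type v) [AddCommGroup A] [Module K A] where
  /-- The operators `δ₁, …, δₘ`. -/
  op : Fin m → Module.End ℤ A
  op_comm : ∀ i j : Fin m, Commute (op i) (op j)
  op_smul : ∀ (i : Fin m) (a : K) (x : A),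
    op i (a • x) = CommutingDerivations.der i a • x + a • op i x

namespace DifferentialModule

section

variable {m : ℕ} (K : Type u) [CommRing K] [CommutingDerivations m K]
  {A : Type v} [AddCommGroup A] [Module K A] [DifferentialModule m K A]

theorem op_pow_comm (e : Fin m →₀ ℕ) (s : Set (Fin m)) :
    s.Pairwise (Function.onFun Commute fun i => (op K i : Module.End ℤ A) ^ e i) :=
  fun i _ j _ _ => (op_comm i j).pow_pow _ _

/-- The operator `δ₁ ^ e₁ ⋯ δₘ ^ eₘ` on a differential module. -/
noncomputable def theta (e : Fin m →₀ ℕ) : Module.End ℤ A :=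
  Finset.univ.noncommProd (fun i => (op K i : Module.End ℤ A) ^ e i) (op_pow_comm K e _)

theorem theta_zero (x : A) : theta K (0 : Fin m →₀ ℕ) x = x := by
  have h : theta K (0 : Fin m →₀ ℕ) = (1 : Module.End ℤ A) :=
    (Finset.noncommProd_eq_pow_card _ _ _ 1 fun i _ => by simp).trans (one_pow _)
  rw [h, Module.End.one_apply]

theorem theta_add (e f : Fin m →₀ ℕ) (x : A) :
    theta K (e + f) x = theta K e (theta K f x) := by
  rw [← Module.End.mul_apply]
  unfold theta
  rw [← Finset.noncommProd_mul_distrib]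
  · congr 1
    refine Finset.noncommProd_congr rfl ?_ _
    intro i _
    simp [pow_add]
  · exact fun i _ j _ _ => (op_comm i j).pow_pow _ _

theorem theta_single (i : Fin m) (x : A) : theta K (Finsupp.single i 1) x = op K i x := by
  congr 1
  unfold theta
  rw [← Finset.mul_noncommProd_erase _ (Finset.mem_univ i) _ (op_pow_comm K _ _) (op_pow_comm K _ _),
    Finset.noncommProd_eq_pow_card _ _ _ 1]
  · simp
  · intro j hj
    simp [Finsupp.single_eq_of_ne (Finset.ne_of_mem_erase hj)]

end

end DifferentialModule

/-- A differential ring is a differential module over itself. -/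
instance CommutingDerivations.selfModule (m : ℕ) (K : Type u) [CommRing K]
    [CommutingDerivations m K] : DifferentialModule m K K where
  op i := (CommutingDerivations.der i : Derivation ℤ K K).toLinearMap
  op_comm i j := by
    ext x
    exact CommutingDerivations.der_comm i j x
  op_smul i a x := by
    simp [mul_comm, add_comm]

/-- The ring `K[Δ]` of linear differential operators: formal finite sums `∑ aₑ δ^e` with
coefficients `aₑ` on the left, where `δ^e = δ₁ ^ e₁ ⋯ δₘ ^ eₘ`. The multiplication, given below,
is the one with `δᵢ δⱼ = δⱼ δᵢ` and `δᵢ a = a δᵢ + δᵢ(a)`. -/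
def DiffOp (m : ℕ) (K : Type u) [CommRing K] : Type u := (Fin m →₀ ℕ) →₀ K

namespace DiffOp

section

variable {m : ℕ} {K : Type u} [CommRing K]

noncomputable instance : AddCommGroup (DiffOp m K) :=
  inferInstanceAs (AddCommGroup ((Fin m →₀ ℕ) →₀ K))

noncomputable instance : Module K (DiffOp m K) :=
  inferInstanceAs (Module K ((Fin m →₀ ℕ) →₀ K))

/-- The operator `a δ^e`. -/
noncomputable def term (e : Fin m →₀ ℕ) (a : K) : DiffOp m K := Finsupp.single e a

theorem term_zero (e : Fin m →₀ ℕ) : term e (0 : K) = 0 := Finsupp.single_zero e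

theorem term_add (e : Fin m →₀ ℕ) (a b : K) : term e (a + b) = term e a + term e b :=
  Finsupp.single_add e a b

theorem smul_term (b : K) (e : Fin m →₀ ℕ) (a : K) : b • term e a = term e (b * a) :=
  Finsupp.smul_single' b e a

noncomputable instance : One (DiffOp m K) := ⟨term 0 1⟩

theorem one_def : (1 : DiffOp m K) = term 0 1 := rfl

theorem induction {p : DiffOp m K → Prop} (P : DiffOp m K) (zero : p 0)
    (add : ∀ P Q, p P → p Q → p (P + Q)) (term : ∀ e a, p (term e a)) : p P :=
  Finsupp.induction_linear (motive := p) P zero add term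

variable [CommutingDerivations m K]

/-- Left multiplication by `δᵢ`: `∑ aₑ δ^e ↦ ∑ δᵢ(aₑ) δ^e + ∑ aₑ δᵢ δ^e`. -/
noncomputable def derMulFun (i : Fin m) (P : (Fin m →₀ ℕ) →₀ K) : (Fin m →₀ ℕ) →₀ K :=
  Finsupp.mapRange (CommutingDerivations.der i : Derivation ℤ K K) (map_zero _) P +
    Finsupp.mapDomain (fun e => Finsupp.single i 1 + e) P

theorem derMulFun_add (i : Fin m) (P Q : (Fin m →₀ ℕ) →₀ K) :
    derMulFun i (P + Q) = derMulFun i P + derMulFun i Q := by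
  unfold derMulFun
  rw [Finsupp.mapRange_add (fun x y => map_add _ x y), Finsupp.mapDomain_add, add_add_add_comm]

theorem derMulFun_single (i : Fin m) (e : Fin m →₀ ℕ) (a : K) :
    derMulFun i (Finsupp.single e a) = Finsupp.single e (CommutingDerivations.der i a) +
      Finsupp.single (Finsupp.single i 1 + e) a := by
  unfold derMulFun
  rw [Finsupp.mapRange_single, Finsupp.mapDomain_single]

/-- Left multiplication by `δᵢ`, as an additive map. -/
noncomputable def derMul (i : Fin m) : Module.End ℤ (DiffOp m K) :=
  (AddMonoidHom.mk' (fun P : DiffOp m K => (derMulFun i P : DiffOp m K))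
    (derMulFun_add i)).toIntLinearMap

theorem derMul_term (i : Fin m) (e : Fin m →₀ ℕ) (a : K) :
    derMul i (term e a) =
      term e (CommutingDerivations.der i a) + term (Finsupp.single i 1 + e) a :=
  derMulFun_single i e a

theorem derMul_comm (i j : Fin m) (P : DiffOp m K) :
    derMul i (derMul j P) = derMul j (derMul i P) := by
  induction P using DiffOp.induction with
  | zero => simp only [map_zero]
  | add P Q hP hQ => simp only [map_add, hP, hQ]
  | term e a =>
    simp only [derMul_term, map_add, CommutingDerivations.der_comm i j a,
      add_left_comm (Finsupp.single i 1) (Finsupp.single j 1) e]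
    abel

theorem derMul_smul (i : Fin m) (a : K) (P : DiffOp m K) :
    derMul i (a • P) = CommutingDerivations.der i a • P + a • derMul i P := by
  induction P using DiffOp.induction with
  | zero => simp only [smul_zero, map_zero, add_zero]
  | add P Q hP hQ => simp only [smul_add, map_add, hP, hQ]; abel
  | term e b =>
    simp only [smul_term, derMul_term, smul_add, Derivation.leibniz, term_add, smul_eq_mul,
      mul_comm b]
    abel

noncomputable instance : DifferentialModule m K (DiffOp m K) where
  op := derMul
  op_comm i j := by
    rw [commute_iff_eq]
    refine LinearMap.ext fun P => ?_
    rw [Module.End.mul_apply, Module.End.mul_apply, derMul_comm]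
  op_smul := derMul_smul

theorem op_eq (i : Fin m) (P : DiffOp m K) : DifferentialModule.op K i P = derMul i P := rfl

section act

variable {A : Type v} [AddCommGroup A] [Module K A] [DifferentialModule m K A]

/-- The action `(∑ aₑ δ^e) x = ∑ aₑ • δ^e(x)` of an operator on a differential module. -/
noncomputable def act (P : DiffOp m K) (x : A) : A :=
  Finsupp.sum P fun e a => a • DifferentialModule.theta K e x

theorem act_term (e : Fin m →₀ ℕ) (a : K) (x : A) :
    act (term e a) x = a • DifferentialModule.theta K e x :=
  Finsupp.sum_single_index (zero_smul K _)

theorem zero_act (x : A) : act (0 : DiffOp m K) x = 0 := Finsupp.sum_zero_index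

theorem add_act (P Q : DiffOp m K) (x : A) : act (P + Q) x = act P x + act Q x :=
  Finsupp.sum_add_index' (fun _ => zero_smul K _) (fun _ _ _ => add_smul _ _ _)

theorem act_zero (P : DiffOp m K) : act P (0 : A) = 0 := by
  induction P using DiffOp.induction with
  | zero => exact zero_act _
  | add P Q hP hQ => rw [add_act, hP, hQ, add_zero]
  | term e a => rw [act_term, map_zero, smul_zero]

theorem act_add (P : DiffOp m K) (x y : A) : act P (x + y) = act P x + act P y := by
  induction P using DiffOp.induction with
  | zero => simp only [zero_act, add_zero]
  | add P Q hP hQ => rw [add_act, hP, hQ, add_act, add_act, add_add_add_comm]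
  | term e a => simp only [act_term, map_add, smul_add]

theorem smul_act (a : K) (P : DiffOp m K) (x : A) : act (a • P) x = a • act P x := by
  induction P using DiffOp.induction with
  | zero => simp only [smul_zero, zero_act]
  | add P Q hP hQ => simp only [smul_add, add_act, hP, hQ]
  | term e b => simp only [smul_term, act_term, mul_smul]

theorem derMul_act (i : Fin m) (P : DiffOp m K) (x : A) :
    act (derMul i P) x = DifferentialModule.op K i (act P x) := by
  induction P using DiffOp.induction with
  | zero => simp only [map_zero, zero_act]
  | add P Q hP hQ => simp only [map_add, add_act, hP, hQ]
  | term e b =>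
    simp only [derMul_term, add_act, act_term, DifferentialModule.op_smul,
      DifferentialModule.theta_add, DifferentialModule.theta_single]

theorem theta_act (e : Fin m →₀ ℕ) (P : DiffOp m K) (x : A) :
    act (DifferentialModule.theta K e P) x = DifferentialModule.theta K e (act P x) := by
  induction e using Finsupp.induction_linear generalizing P with
  | zero => simp only [DifferentialModule.theta_zero]
  | add e f he hf => simp only [DifferentialModule.theta_add, he, hf]
  | single i n =>
    induction n generalizing P with
    | zero => simp only [Finsupp.single_zero, DifferentialModule.theta_zero]
    | succ n ih =>
      simp only [Finsupp.single_add, DifferentialModule.theta_add, ih,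
        DifferentialModule.theta_single, op_eq, derMul_act]

theorem act_act (P Q : DiffOp m K) (x : A) : act (act P Q) x = act P (act Q x) := by
  induction P using DiffOp.induction with
  | zero => simp only [zero_act]
  | add P P' hP hP' => simp only [add_act, hP, hP']
  | term e b => simp only [act_term, smul_act, theta_act]

end act

/-- The product of two operators: `(∑ aₑ δ^e) Q = ∑ aₑ δ^e(Q)`, where `δᵢ` acts on operators by
`δᵢ (∑ b_f δ^f) = ∑ (δᵢ(b_f) δ^f + b_f δᵢ δ^f)`. -/
noncomputable instance : Mul (DiffOp m K) := ⟨fun P Q => act P Q⟩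

theorem mul_def (P Q : DiffOp m K) : P * Q = act P Q := rfl

theorem one_act {A : Type v} [AddCommGroup A] [Module K A] [DifferentialModule m K A] (x : A) :
    act (1 : DiffOp m K) x = x := by
  rw [one_def, act_term, DifferentialModule.theta_zero, one_smul]

theorem theta_term_one (e f : Fin m →₀ ℕ) :
    DifferentialModule.theta K e (term f (1 : K)) = term (e + f) (1 : K) := by
  induction e using Finsupp.induction_linear generalizing f with
  | zero => simp only [DifferentialModule.theta_zero, zero_add]
  | add e e' he he' => simp only [DifferentialModule.theta_add, he, he', add_assoc]
  | single i n =>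
    induction n generalizing f with
    | zero => simp only [Finsupp.single_zero, DifferentialModule.theta_zero, zero_add]
    | succ n ih =>
      simp only [Finsupp.single_add, DifferentialModule.theta_add,
        DifferentialModule.theta_single, op_eq, derMul_term, Derivation.map_one_eq_zero,
        term_zero, zero_add, ih, add_assoc]

theorem act_one (P : DiffOp m K) : act P (1 : DiffOp m K) = P := by
  induction P using DiffOp.induction with
  | zero => exact zero_act _
  | add P Q hP hQ => rw [add_act, hP, hQ]
  | term e a => rw [one_def, act_term, theta_term_one, smul_term, add_zero, mul_one]

noncomputable instance : Ring (DiffOp m K) where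
  __ := (inferInstance : AddCommGroup (DiffOp m K))
  mul_assoc P Q R := act_act P Q R
  one_mul P := one_act P
  mul_one P := act_one P
  left_distrib P Q R := act_add P Q R
  right_distrib P Q R := add_act P Q R
  zero_mul P := zero_act P
  mul_zero P := act_zero P

/-- The commutation rule `δᵢ a = a δᵢ + δᵢ(a)`. -/
theorem der_mul_const (i : Fin m) (a : K) :
    (term (Finsupp.single i 1) 1 * term 0 a : DiffOp m K) =
      term (Finsupp.single i 1) a + term 0 (CommutingDerivations.der i a) := by
  rw [mul_def, act_term, DifferentialModule.theta_single, one_smul, op_eq, derMul_term, add_zero,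
    add_comm]

/-- Monomials multiply by `a δ^e · δ^f = a δ^(e+f)`. -/
theorem term_mul_term_one (e f : Fin m →₀ ℕ) (a : K) :
    (term e a * term f 1 : DiffOp m K) = term (e + f) a := by
  rw [mul_def, act_term, theta_term_one, smul_term, mul_one]

/-- The left `K[Δ]`-module `K`: `(∑ aₑ δ^e) • x = ∑ aₑ δ^e(x)`. -/
noncomputable instance : Module (DiffOp m K) K where
  smul P x := act P x
  one_smul x := one_act x
  mul_smul P Q x := act_act P Q x
  smul_zero P := act_zero P
  smul_add P x y := act_add P x y
  add_smul P Q x := add_act P Q x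
  zero_smul x := zero_act x

theorem smul_def (P : DiffOp m K) (x : K) : P • x = act P x := rfl

end

end DiffOp

/-- The ring `K{y₁, …, yₙ}` of differential polynomials: polynomials in the derivatives
`δ^e yᵢ`. -/
abbrev DiffPolynomial (m n : ℕ) (K : Type u) [CommRing K] : Type u :=
  MvPolynomial (Fin n × (Fin m →₀ ℕ)) K

/-- The value `f(a)` of a differential polynomial over `K` at a point `a` of `Lⁿ`: each `δ^e yᵢ`
is replaced by `δ^e(aᵢ)`. -/
noncomputable def DiffPolynomial.value {m n : ℕ} {K : Type u} [CommRing K] {L : Type v} [CommRing L]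
    [CommutingDerivations m L] [Algebra K L] (f : DiffPolynomial m n K) (a : Fin n → L) : L :=
  MvPolynomial.aeval (fun p : Fin n × (Fin m →₀ ℕ) => DifferentialModule.theta L p.2 (a p.1)) f

/-- `K` is differentially closed (with respect to its `m` commuting derivations): every finite
system `f = 0 (f ∈ F)`, `g ≠ 0` of differential polynomial equations and an inequation over `K`
that has a solution in some differential field extension of `K` has a solution in `K`. -/
def IsDifferentiallyClosed (m : ℕ) (K : Type u) [Field K] [CommutingDerivations m K] : Prop :=
  ∀ (n : ℕ) (F : Finset (DiffPolynomial m n K)) (g : DiffPolynomial m n K),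
    (∃ (L : Type u) (_ : Field L) (_ : CommutingDerivations m L) (_ : Algebra K L),
      (∀ (i : Fin m) (x : K), CommutingDerivations.der i (algebraMap K L x) =
        algebraMap K L (CommutingDerivations.der i x)) ∧
      ∃ a : Fin n → L, (∀ f ∈ F, f.value a = 0) ∧ g.value a ≠ 0) →
    ∃ a : Fin n → K, (∀ f ∈ F, f.value a = 0) ∧ g.value a ≠ 0

namespace LinearDifferential

section

variable {m n : ℕ} {K : Type u} [Field K] [CommutingDerivations m K]

/-- The value `ξ(x) = ξ₁ x₁ + ⋯ + ξₙ xₙ` of the linear differential function `ξ ∈ K[Δ]ⁿ`. -/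
noncomputable def value (ξ : Fin n → DiffOp m K) (x : Fin n → K) : K :=
  ∑ i, ξ i • x i

/-- `V(N)`, the set of common zeros of a differential submodule `N` of `K[Δ]ⁿ`. -/
def zeros (N : Submodule (DiffOp m K) (Fin n → DiffOp m K)) : Set (Fin n → K) :=
  {x | ∀ ξ ∈ N, value ξ x = 0}

/-- `I(X)`, the differential submodule of linear differential functions vanishing on `X`. -/
noncomputable def vanishing (m : ℕ) [CommutingDerivations m K] (X : Set (Fin n → K)) :
    Submodule (DiffOp m K) (Fin n → DiffOp m K) where
  carrier := {ξ | ∀ x ∈ X, value ξ x = 0}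
  zero_mem' x _ := by simp [value]
  add_mem' {ξ η} hξ hη x hx := by
    have h : value (ξ + η) x = value ξ x + value η x := by
      simp only [value, Pi.add_apply, add_smul, Finset.sum_add_distrib]
    rw [h, hξ x hx, hη x hx, add_zero]
  smul_mem' P ξ hξ x hx := by
    have h : value (P • ξ) x = P • value ξ x := by
      simp only [value, Pi.smul_apply, smul_eq_mul, mul_smul, Finset.smul_sum]
    rw [h, hξ x hx, smul_zero]

/-- Linear differential spaces: the subsets of `Kⁿ` of the form `V(N)`. -/
def IsLinearDifferentialSpace (m : ℕ) [CommutingDerivations m K] (X : Set (Fin n → K)) : Prop :=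
  ∃ N : Submodule (DiffOp m K) (Fin n → DiffOp m K), X = zeros N

end

end LinearDifferential

/-! The only nontrivial inclusion is `I(V(N)) ⊆ N`. Suppose `η ∉ N`. In the left module `M = K[Δ]ⁿ /
N` the classes of the standard basis vectors form a generic zero of `N`: a linear function `ξ` takes
at this point the class of `ξ` as its value, so every element of `N` vanishes there and `η` does
not. It remains to move this point into `Kⁿ`, which takes two facts.

`M` embeds into a differential field extension `L` of `K` (`exists_differentialField_embedding`):
`L` is the field of rational functions in a `K`-basis of `M`, with `δᵢ` extended from the constants
and the action on `M`. Hence the equations `ξ = 0` for `ξ ∈ N` and the inequation `η ≠ 0` are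
solvable in `L`.

Differential closedness handles only finite systems, so `N` must be finitely generated. This follows
from `DiffOp.isNoetherianRing`, proved by leading exponents and Dickson's lemma. A solution in `K`
is then a point of `V(N)` at which `η` does not vanish. -/

namespace DiffOp

open MonomialOrder

/-! ### Leading exponents and the Noetherian property of `K[Δ]`. -/

section Noetherian

variable {m : ℕ} {K : Type u} [Field K]

/-- The operators all of whose exponents are smaller than `e` in the lexicographic order. -/
noncomputable def lower (e : Fin m →₀ ℕ) : Submodule K (DiffOp m K) :=
  (Finsupp.supported K K {f | f ≺[lex] e} : Submodule K ((Fin m →₀ ℕ) →₀ K))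

theorem term_mem_lower {e f : Fin m →₀ ℕ} (h : f ≺[lex] e) (a : K) : term f a ∈ lower e :=
  Finsupp.single_mem_supported K a h

/-- The coefficient of `δ^e`. -/
noncomputable def coeff (P : DiffOp m K) (e : Fin m →₀ ℕ) : K :=
  (show (Fin m →₀ ℕ) →₀ K from P) e

theorem mem_lower {e : Fin m →₀ ℕ} {P : DiffOp m K} :
    P ∈ lower e ↔ ∀ f, P.coeff f ≠ 0 → f ≺[lex] e :=
  (Finsupp.mem_supported K _).trans
    ⟨fun h _ hf => h (Finsupp.mem_support_iff.2 hf), fun h f hf => h f (Finsupp.mem_support_iff.1 hf)⟩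

theorem lower_induction {e : Fin m →₀ ℕ} {p : DiffOp m K → Prop} {P : DiffOp m K}
    (hP : P ∈ lower e) (zero : p 0) (add : ∀ P Q, p P → p Q → p (P + Q))
    (term : ∀ f a, f ≺[lex] e → p (term f a)) : p P := by
  have h : P = Finsupp.sum P fun f a => DiffOp.term f a := (Finsupp.sum_single P).symm
  rw [h]
  exact Finset.sum_induction _ p add zero fun f hf =>
    term f _ ((Finsupp.mem_supported K _).1 hP hf)

/-- A nonzero operator is its leading term plus lower terms. -/
theorem exists_sub_term_mem_lower {P : DiffOp m K} (hP : P ≠ 0) :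
    ∃ e : Fin m →₀ ℕ, P.coeff e ≠ 0 ∧ P - term e (P.coeff e) ∈ lower e := by
  let s : Finset (Fin m →₀ ℕ) := Finsupp.support (show (Fin m →₀ ℕ) →₀ K from P)
  have hs : s.Nonempty := Finsupp.support_nonempty_iff.2 hP
  obtain ⟨e, he, hmax⟩ := s.exists_max_image (lex (σ := Fin m)).toSyn hs
  refine ⟨e, Finsupp.mem_support_iff.1 he, mem_lower.2 fun f hf => ?_⟩
  have hc : (P - term e (P.coeff e)).coeff f = P.coeff f - Finsupp.single e (P.coeff e) f :=
    Finsupp.sub_apply _ _ _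
  rw [hc] at hf
  by_cases hfe : e = f
  · subst hfe
    simp at hf
  · rw [Finsupp.single_eq_of_ne' hfe, sub_zero] at hf
    refine lt_of_le_of_ne (hmax f (Finsupp.mem_support_iff.2 hf)) fun h => hfe ?_
    exact ((lex (σ := Fin m)).toSyn.injective h).symm

variable [CommutingDerivations m K]

/-- Since `δᵢ (a δ^f) = δᵢ(a) δ^f + a δᵢ δ^f`, the noncommutative correction has a smaller exponent
than the main term, and the lexicographic order is translation invariant. Leading exponents
therefore behave as for commutative polynomials. -/
theorem derMul_mem_lower (i : Fin m) {e : Fin m →₀ ℕ} {P : DiffOp m K} (hP : P ∈ lower e) :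
    derMul i P ∈ lower (Finsupp.single i 1 + e) := by
  refine lower_induction (p := fun P => derMul i P ∈ lower (Finsupp.single i 1 + e)) hP ?_ ?_ ?_
  · rw [map_zero]
    exact Submodule.zero_mem _
  · intro P Q hP hQ
    rw [map_add]
    exact Submodule.add_mem _ hP hQ
  · intro f a hf
    rw [derMul_term]
    refine Submodule.add_mem _ (term_mem_lower ?_ _) (term_mem_lower ?_ _)
    · refine hf.trans_le ?_
      exact (lex (σ := Fin m)).toSyn_monotone le_add_self
    · rw [map_add, map_add]
      exact add_lt_add_right hf _

theorem theta_mem_lower (f : Fin m →₀ ℕ) {e : Fin m →₀ ℕ} {P : DiffOp m K} (hP : P ∈ lower e) :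
    DifferentialModule.theta K f P ∈ lower (f + e) := by
  induction f using Finsupp.induction_linear generalizing P e with
  | zero => simpa only [DifferentialModule.theta_zero, zero_add] using hP
  | add f g hf hg =>
    rw [DifferentialModule.theta_add, add_assoc]
    exact hf (hg hP)
  | single i n =>
    induction n generalizing P e with
    | zero => simpa only [Finsupp.single_zero, DifferentialModule.theta_zero, zero_add] using hP
    | succ n ih =>
      rw [Finsupp.single_add, DifferentialModule.theta_add, DifferentialModule.theta_single,
        add_assoc, op_eq]
      exact ih (derMul_mem_lower i hP)

instance : IsScalarTower K (DiffOp m K) (DiffOp m K) :=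
  ⟨fun a P Q => smul_act a P Q⟩

/-- The exponents of leading terms of elements of a left ideal. -/
def leads (I : Submodule (DiffOp m K) (DiffOp m K)) : Set (Fin m →₀ ℕ) :=
  {e | ∃ P ∈ I, P - term e 1 ∈ lower e}

theorem add_mem_leads {I : Submodule (DiffOp m K) (DiffOp m K)} {e : Fin m →₀ ℕ}
    (he : e ∈ leads I) (f : Fin m →₀ ℕ) : f + e ∈ leads I := by
  obtain ⟨P, hP, hPe⟩ := he
  refine ⟨term f 1 * P, I.smul_mem _ hP, ?_⟩
  rw [← term_mul_term_one, ← mul_sub, mul_def, act_term, one_smul]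
  exact theta_mem_lower f hPe

/-- Division argument: subtracting from an element of `J` a multiple of an element of `I` with the
same leading exponent lowers the leading exponent, and the lexicographic order on exponents is
well-founded. -/
theorem le_of_leads_subset {I J : Submodule (DiffOp m K) (DiffOp m K)} (hIJ : I ≤ J)
    (h : leads J ⊆ leads I) : J ≤ I := by
  have key : ∀ s : (lex (σ := Fin m)).syn, ∀ (e : Fin m →₀ ℕ), lex.toSyn e = s →
      ∀ (P : DiffOp m K) (c : K), P ∈ J → c ≠ 0 → P - term e c ∈ lower e → P ∈ I := by
    intro s
    induction s using WellFoundedLT.induction with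
    | ind s ih =>
      rintro e rfl P c hP hc hPe
      -- `leads` asks for leading coefficient `1`, so `P` is normalized by `c⁻¹`.
      obtain ⟨Q, hQ, hQe⟩ : e ∈ leads I := h ⟨c⁻¹ • P, J.smul_of_tower_mem _ hP, by
        have := (lower e).smul_mem c⁻¹ hPe
        rwa [smul_sub, smul_term, inv_mul_cancel₀ hc] at this⟩
      have hR : P - c • Q ∈ lower e := by
        have := (lower e).sub_mem hPe ((lower e).smul_mem c hQe)
        rw [smul_sub, smul_term, mul_one] at this
        simpa using this
      have hRJ : P - c • Q ∈ J := J.sub_mem hP (J.smul_of_tower_mem _ (hIJ hQ))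
      suffices P - c • Q ∈ I by
        simpa using I.add_mem this (I.smul_of_tower_mem c hQ)
      by_cases h0 : P - c • Q = 0
      · rw [h0]
        exact I.zero_mem
      · obtain ⟨f, hd, hf⟩ := exists_sub_term_mem_lower h0
        exact ih _ (mem_lower.1 hR f hd) f rfl _ _ hRJ hd hf
  intro P hP
  by_cases h0 : P = 0
  · rw [h0]
    exact I.zero_mem
  · obtain ⟨e, hc, he⟩ := exists_sub_term_mem_lower h0
    exact key _ e rfl P _ hP hc he

/-- The set of leading exponents of a left ideal is closed upwards under the componentwise order, so
it is determined by its minimal elements. Operators realizing these minimal exponents generate the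
ideal. -/
instance isNoetherianRing : IsNoetherianRing (DiffOp m K) := by
  refine ⟨fun I => ?_⟩
  let S : Set (Fin m →₀ ℕ) := {e | Minimal (· ∈ leads I) e}
  -- Dickson's lemma: antichains of exponents are finite.
  have hS : S.Finite := WellQuasiOrderedLE.finite_of_isAntichain (setOfPred_minimal_antichain _)
  have hex : ∀ e : S, ∃ P ∈ I, P - term e.1 1 ∈ lower e.1 := fun e => e.2.prop
  choose P hPI hP using hex
  have := hS.to_subtype
  have hle : Submodule.span (DiffOp m K) (Set.range P) ≤ I :=
    Submodule.span_le.2 (Set.range_subset_iff.2 hPI)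
  have heq : Submodule.span (DiffOp m K) (Set.range P) = I := by
    refine le_antisymm hle (le_of_leads_subset hle fun e he => ?_)
    obtain ⟨f, hfe, hf⟩ := exists_minimal_le_of_wellFoundedLT (· ∈ leads I) e he
    obtain ⟨g, rfl⟩ := exists_add_of_le hfe
    rw [add_comm]
    exact add_mem_leads ⟨P ⟨f, hf⟩, Submodule.subset_span (Set.mem_range_self _), hP ⟨f, hf⟩⟩ g
  rw [← heq]
  exact Submodule.fg_span (Set.finite_range P)

end Noetherian

end DiffOp

/-! ### Embedding differential vector spaces into differential fields. -/

section Derivations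

variable {ι K F : Type*} [Field K] [Field F] [Algebra (MvPolynomial ι K) F]
  [IsFractionRing (MvPolynomial ι K) F] [Algebra K F] [IsScalarTower K (MvPolynomial ι K) F]

/-- A derivation of a field of rational functions can be prescribed on the constants and on the
variables. -/
theorem exists_derivation_of_isFractionRing_mvPolynomial (d : Derivation ℤ K K) (y : ι → F) :
    ∃ D : Derivation ℤ F F, (∀ a : K, D (algebraMap K F a) = algebraMap K F (d a)) ∧
      ∀ b, D (algebraMap (MvPolynomial ι K) F (MvPolynomial.X b)) = y b := by
  -- A derivation `D` of `F` is the same as a ring homomorphism `x ↦ x + D(x) ε` into the dual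
  -- numbers over `F`. This homomorphism is built on constants, then on polynomials, then on
  -- fractions.
  let φ₀ : K →+* TrivSqZeroExt F F :=
    { toFun a := TrivSqZeroExt.inl (algebraMap K F a) + TrivSqZeroExt.inr (algebraMap K F (d a))
      map_one' := by ext <;> simp
      map_mul' a b := by
        refine TrivSqZeroExt.ext ?_ ?_
        · simp
        · simp only [TrivSqZeroExt.snd_add, TrivSqZeroExt.snd_inl, TrivSqZeroExt.snd_inr,
            TrivSqZeroExt.snd_mul, TrivSqZeroExt.fst_add, TrivSqZeroExt.fst_inl,
            TrivSqZeroExt.fst_inr, Derivation.leibniz, smul_eq_mul, op_smul_eq_smul, map_add,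
            map_mul, zero_add, add_zero]
      map_zero' := by ext <;> simp
      map_add' a b := by
        simp only [map_add, TrivSqZeroExt.inl_add, TrivSqZeroExt.inr_add, add_add_add_comm] }
  let φ₁ : MvPolynomial ι K →+* TrivSqZeroExt F F := MvPolynomial.eval₂Hom φ₀ fun b =>
    TrivSqZeroExt.inl (algebraMap (MvPolynomial ι K) F (MvPolynomial.X b)) +
      TrivSqZeroExt.inr (y b)
  have hfst : ∀ p, (φ₁ p).fst = algebraMap (MvPolynomial ι K) F p := by
    have : (TrivSqZeroExt.fstHom F F F : TrivSqZeroExt F F →+* F).comp φ₁ =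
        algebraMap (MvPolynomial ι K) F := by
      refine MvPolynomial.ringHom_ext (fun a => ?_) fun b => ?_
      · simp [φ₁, φ₀, IsScalarTower.algebraMap_apply K (MvPolynomial ι K) F,
          MvPolynomial.algebraMap_eq]
      · simp [φ₁]
    exact fun p => RingHom.congr_fun this p
  -- A dual number is invertible as soon as its first component is, so denominators cause no
  -- obstruction.
  have hunit : ∀ p : nonZeroDivisors (MvPolynomial ι K), IsUnit (φ₁ p) := fun p => by
    rw [TrivSqZeroExt.isUnit_iff_isUnit_fst, hfst]
    exact IsLocalization.map_units F p
  let φ : F →+* TrivSqZeroExt F F := IsLocalization.lift hunit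
  have hφ : ∀ p, φ (algebraMap (MvPolynomial ι K) F p) = φ₁ p := IsLocalization.lift_eq hunit
  have hφfst : ∀ x : F, (φ x).fst = x := by
    have : (TrivSqZeroExt.fstHom F F F : TrivSqZeroExt F F →+* F).comp φ = RingHom.id F := by
      refine IsLocalization.ringHom_ext (nonZeroDivisors (MvPolynomial ι K))
        (RingHom.ext fun p => ?_)
      simp [hφ, hfst]
    exact fun x => RingHom.congr_fun this x
  let D : Derivation ℤ F F := Derivation.mk'
    ((TrivSqZeroExt.sndHom F F).toAddMonoidHom.comp φ.toAddMonoidHom).toIntLinearMap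
    (fun x y => by simp [hφfst, mul_comm y])
  have hD : ∀ x, D x = (φ x).snd := fun _ => rfl
  refine ⟨D, fun a => ?_, fun b => ?_⟩
  · rw [hD, IsScalarTower.algebraMap_apply K (MvPolynomial ι K) F, hφ]
    simp [φ₁, φ₀, MvPolynomial.algebraMap_eq, Algebra.algebraMap_eq_smul_one]
  · rw [hD, hφ]
    simp [φ₁]

/-- A derivation of a field of rational functions is determined by its values at the constants
and at the variables. -/
theorem derivation_eq_zero_of_isFractionRing_mvPolynomial (D : Derivation ℤ F F)
    (hC : ∀ a : K, D (algebraMap K F a) = 0)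
    (hX : ∀ b, D (algebraMap (MvPolynomial ι K) F (MvPolynomial.X b)) = 0) : D = 0 := by
  have hP : ∀ p, D (algebraMap (MvPolynomial ι K) F p) = 0 := by
    intro p
    induction p using MvPolynomial.induction_on with
    | C a =>
      rw [← MvPolynomial.algebraMap_eq, ← IsScalarTower.algebraMap_apply]
      exact hC a
    | add p q hp hq => rw [map_add, map_add, hp, hq, add_zero]
    | mul_X p b hp => rw [map_mul, Derivation.leibniz, hp, hX, smul_zero, smul_zero, add_zero]
  ext x
  obtain ⟨p, q, hq, rfl⟩ := IsFractionRing.div_surjective (A := MvPolynomial ι K) x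
  have hq0 : algebraMap (MvPolynomial ι K) F q ≠ 0 :=
    IsFractionRing.to_map_ne_zero_of_mem_nonZeroDivisors hq
  -- Writing the numerator as `(p / q) * q` and applying Leibniz with `D q = 0` leaves `q * D (p /
  -- q) = 0`.
  have h := hP p
  rw [← div_mul_cancel₀ (algebraMap (MvPolynomial ι K) F p) hq0,
    Derivation.leibniz, hP, smul_zero, zero_add, smul_eq_mul] at h
  exact (mul_eq_zero.1 h).resolve_left hq0

/-- A differential vector space over `K` with basis `B` embeds into the field of rational functions
in variables indexed by `B`, with suitable commuting derivations. -/
theorem exists_commutingDerivations_of_isFractionRing_mvPolynomial {m : ℕ}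
    [CommutingDerivations m K] {M : Type*} [AddCommGroup M] [Module K M]
    [DifferentialModule m K M] (B : Module.Basis ι K M) :
    ∃ (_ : CommutingDerivations m F) (j : M →ₗ[K] F), Function.Injective j ∧
      (∀ (i : Fin m) (a : K), CommutingDerivations.der i (algebraMap K F a) =
        algebraMap K F (CommutingDerivations.der i a)) ∧
      ∀ (i : Fin m) (x : M),
        CommutingDerivations.der i (j x) = j (DifferentialModule.op K i x) := by
  let j : M →ₗ[K] F := B.constr K fun b => algebraMap (MvPolynomial ι K) F (MvPolynomial.X b)
  have hjB : ∀ b, j (B b) = algebraMap (MvPolynomial ι K) F (MvPolynomial.X b) :=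
    fun b => B.constr_basis K _ b
  have hj : Function.Injective j := B.injective_constr_of_linearIndependent
    ((MvPolynomial.linearIndependent_X ι K).map_injOn
      (IsScalarTower.toAlgHom K (MvPolynomial ι K) F).toLinearMap
        (IsFractionRing.injective (MvPolynomial ι K) F).injOn)
  -- Each variable stands for a basis vector, so its derivative is forced to be the linear form
  -- representing `δᵢ` of that vector.
  choose D hDC hDX using fun i : Fin m => exists_derivation_of_isFractionRing_mvPolynomial
    (CommutingDerivations.der i : Derivation ℤ K K) fun b => j (DifferentialModule.op K i (B b))
  have hDj : ∀ i x, D i (j x) = j (DifferentialModule.op K i x) := by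
    intro i x
    induction B.mem_span x using Submodule.span_induction with
    | mem x hx =>
      obtain ⟨b, rfl⟩ := hx
      rw [hjB, hDX]
    | zero => simp only [map_zero]
    | add x y _ _ hx hy => simp only [map_add, hx, hy]
    | smul a x _ hx =>
      rw [DifferentialModule.op_smul, map_add, j.map_smul, j.map_smul, j.map_smul, ← hx,
        Algebra.smul_def, Algebra.smul_def, Algebra.smul_def, Derivation.leibniz, hDC,
        smul_eq_mul, smul_eq_mul, add_comm, mul_comm (j x)]
  -- The commutator is again a derivation. It kills the constants because the `δᵢ` commute on `K`,
  -- and the variables because they commute on `M`.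
  have hcomm : ∀ i k, ⁅D i, D k⁆ = 0 := fun i k => by
    refine derivation_eq_zero_of_isFractionRing_mvPolynomial (ι := ι) (K := K) _ (fun a => ?_)
      fun b => ?_
    · rw [Derivation.commutator_apply, hDC, hDC, hDC, hDC, CommutingDerivations.der_comm, sub_self]
    · rw [Derivation.commutator_apply, ← hjB, hDj, hDj, hDj, hDj, ← Module.End.mul_apply,
        ← Module.End.mul_apply, (DifferentialModule.op_comm i k).eq, sub_self]
  refine ⟨⟨D, fun i k x => ?_⟩, j, hj, hDC, hDj⟩
  have := DFunLike.congr_fun (hcomm i k) x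
  rw [Derivation.commutator_apply] at this
  exact sub_eq_zero.1 this

end Derivations

/-- Every differential vector space over `K` embeds into a differential field extension of `K`. -/
theorem exists_differentialField_embedding {m : ℕ} {K : Type u} [Field K]
    [CommutingDerivations m K] (M : Type u) [AddCommGroup M] [Module K M]
    [DifferentialModule m K M] :
    ∃ (L : Type u) (_ : Field L) (_ : CommutingDerivations m L) (_ : Algebra K L)
      (j : M →ₗ[K] L), Function.Injective j ∧
      (∀ (i : Fin m) (a : K), CommutingDerivations.der i (algebraMap K L a) =
        algebraMap K L (CommutingDerivations.der i a)) ∧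
      ∀ (i : Fin m) (x : M),
        CommutingDerivations.der i (j x) = j (DifferentialModule.op K i x) := by
  obtain ⟨inst, j, hj⟩ := exists_commutingDerivations_of_isFractionRing_mvPolynomial (m := m)
    (F := FractionRing (MvPolynomial (Module.Basis.ofVectorSpaceIndex K M) K))
    (Module.Basis.ofVectorSpace K M)
  exact ⟨_, inferInstance, inst, inferInstance, j, hj⟩

namespace DifferentialModule

/-- An additive map commuting with the operators `δᵢ` commutes with all the `δ^e`. -/
theorem map_theta {m : ℕ} {K : Type*} [CommRing K] [CommutingDerivations m K] {A : Type*}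
    [AddCommGroup A] [Module K A] [DifferentialModule m K A] {L : Type*} [CommRing L]
    [CommutingDerivations m L] {B : Type*} [AddCommGroup B] [Module L B] [DifferentialModule m L B]
    (j : A →+ B) (hj : ∀ (i : Fin m) (x : A), op L i (j x) = j (op K i x)) (e : Fin m →₀ ℕ)
    (x : A) : theta L e (j x) = j (theta K e x) := by
  induction e using Finsupp.induction_linear generalizing x with
  | zero => simp only [theta_zero]
  | add e f he hf => simp only [theta_add, he, hf]
  | single i n =>
    induction n generalizing x with
    | zero => simp only [Finsupp.single_zero, theta_zero]
    | succ n ih => simp only [Finsupp.single_add, theta_add, theta_single, hj, ih]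

end DifferentialModule

/-! ### Left `K[Δ]`-modules as differential modules. -/

namespace DiffOp

section

variable {m : ℕ} {K : Type*} [Field K] [CommutingDerivations m K] (M : Type*) [AddCommGroup M]
  [Module K M] [Module (DiffOp m K) M] [IsScalarTower K (DiffOp m K) M]

theorem smul_one_eq_term (a : K) : a • (1 : DiffOp m K) = term 0 a := by
  rw [one_def, smul_term, mul_one]

/-- A left `K[Δ]`-module is a differential module over `K`. -/
@[reducible]
noncomputable def differentialModule : DifferentialModule m K M where
  op i := Module.toAddMonoidEnd (DiffOp m K) M (term (Finsupp.single i 1) 1) |>.toIntLinearMap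
  op_comm i j := by
    rw [commute_iff_eq]
    refine LinearMap.ext fun x => ?_
    change term (Finsupp.single i 1) (1 : K) • term (Finsupp.single j 1) (1 : K) • x =
      term (Finsupp.single j 1) (1 : K) • term (Finsupp.single i 1) (1 : K) • x
    rw [smul_smul, smul_smul, term_mul_term_one, term_mul_term_one, add_comm]
  op_smul i a x := by
    change term (Finsupp.single i 1) (1 : K) • a • x =
      CommutingDerivations.der i a • x + a • term (Finsupp.single i 1) (1 : K) • x
    rw [← one_smul (DiffOp m K) x, ← smul_assoc a, ← smul_assoc (CommutingDerivations.der i a),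
      smul_smul, smul_one_eq_term, smul_one_eq_term, der_mul_const, one_smul, ← smul_assoc,
      smul_term, mul_one, add_smul, add_comm]

/-- The map `Q ↦ Q • x` commutes with the `δᵢ`, hence with every `δ^e`; evaluating at `Q = 1` gives
the claim for monomials. -/
theorem act_eq_smul (P : DiffOp m K) (x : M) :
    letI := differentialModule (m := m) (K := K) M
    act P x = P • x := by
  let := differentialModule (m := m) (K := K) M
  have h : ∀ Q : DiffOp m K, ∀ e, DifferentialModule.theta K e (Q • x) =
      DifferentialModule.theta K e Q • x := fun Q e =>
    DifferentialModule.map_theta (K := K) (L := K) (AddMonoidHom.flip (smulAddHom (DiffOp m K) M) x)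
      (fun i Q => by
        change term (Finsupp.single i 1) (1 : K) • Q • x = derMul i Q • x
        rw [smul_smul, mul_def, act_term, one_smul, DifferentialModule.theta_single, op_eq]) e Q
  induction P using DiffOp.induction with
  | zero => rw [zero_act, zero_smul]
  | add P Q hP hQ => rw [add_act, hP, hQ, add_smul]
  | term e a =>
    have := h 1 e
    rw [one_smul] at this
    rw [act_term, this, one_def, theta_term_one, ← smul_assoc, smul_term, mul_one, add_zero]

end

end DiffOp

/-! ### Linear differential polynomials and the equality `I(V(N)) = N`. -/

namespace LinearDifferential

variable {m n : ℕ}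

/-- The linear differential polynomial `ξ₁ y₁ + ⋯ + ξₙ yₙ`. -/
noncomputable def toDiffPolynomial {K : Type*} [CommRing K] (ξ : Fin n → DiffOp m K) :
    DiffPolynomial m n K :=
  ∑ i, Finsupp.sum (ξ i) fun e a => a • MvPolynomial.X (i, e)

theorem value_toDiffPolynomial {K : Type*} [CommRing K] {L : Type*} [CommRing L]
    [CommutingDerivations m L] [Algebra K L] (ξ : Fin n → DiffOp m K) (x : Fin n → L) :
    (toDiffPolynomial ξ).value x =
      ∑ i, Finsupp.sum (ξ i) fun e a => a • DifferentialModule.theta L e (x i) := by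
  simp only [DiffPolynomial.value, toDiffPolynomial, Finsupp.sum, map_sum, map_smul,
    MvPolynomial.aeval_X]

theorem value_toDiffPolynomial_self {K : Type*} [Field K] [CommutingDerivations m K]
    (ξ : Fin n → DiffOp m K) (x : Fin n → K) : (toDiffPolynomial ξ).value x = value ξ x :=
  value_toDiffPolynomial ξ x

/-- An embedding of the left module `M` into a differential field extension turns values of
linear differential polynomials into linear combinations in `M`. -/
theorem value_toDiffPolynomial_map {K : Type*} [Field K] [CommutingDerivations m K] {M : Type*}
    [AddCommGroup M] [Module K M] [Module (DiffOp m K) M] [IsScalarTower K (DiffOp m K) M]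
    {L : Type*} [CommRing L] [CommutingDerivations m L] [Algebra K L] (j : M →ₗ[K] L)
    (hj : ∀ (i : Fin m) (x : M), CommutingDerivations.der i (j x) =
      j ((DiffOp.differentialModule (m := m) (K := K) M).op i x))
    (ξ : Fin n → DiffOp m K) (x : Fin n → M) :
    (toDiffPolynomial ξ).value (fun i => j (x i)) = j (∑ i, ξ i • x i) := by
  let := DiffOp.differentialModule (m := m) (K := K) M
  rw [value_toDiffPolynomial, map_sum]
  refine Finset.sum_congr rfl fun i _ => ?_
  rw [← DiffOp.act_eq_smul, DiffOp.act]
  refine Eq.trans ?_ (map_sum j _ _).symm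
  refine Finset.sum_congr rfl fun e _ => ?_
  rw [map_smul]
  exact congrArg _ (DifferentialModule.map_theta (K := K) (L := L) j.toAddMonoidHom hj e (x i))

/-- Over a differentially closed field, a linear differential function vanishing on the zeros of a
differential submodule belongs to it. -/
theorem vanishing_zeros {K : Type u} [Field K] [CommutingDerivations m K]
    (hK : IsDifferentiallyClosed m K) (N : Submodule (DiffOp m K) (Fin n → DiffOp m K)) :
    vanishing m (zeros N) = N := by
  refine le_antisymm (fun η hη => ?_) fun ξ hξ x hx => hx ξ hξ
  by_contra hηN
  -- Finite generation turns the conditions defining `V(N)` into a finite system.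
  obtain ⟨S, rfl⟩ : N.FG := IsNoetherian.noetherian N
  set N := Submodule.span (DiffOp m K) (S : Set (Fin n → DiffOp m K))
  classical
  let := DiffOp.differentialModule (m := m) (K := K) ((Fin n → DiffOp m K) ⧸ N)
  obtain ⟨L, _, _, _, j, hj, hLK, hop⟩ :=
    exists_differentialField_embedding (m := m) (K := K) ((Fin n → DiffOp m K) ⧸ N)
  -- The generic zero: at the images in `L` of the classes of the standard basis vectors, `ξ` takes
  -- the image of its own class modulo `N` as its value.
  have hval : ∀ ξ : Fin n → DiffOp m K,
      (toDiffPolynomial ξ).value (fun i => j (N.mkQ (Pi.single i 1))) = j (N.mkQ ξ) := fun ξ => by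
    rw [value_toDiffPolynomial_map j hop ξ fun i => N.mkQ (Pi.single i 1)]
    simp only [← map_smul, ← map_sum]
    rw [← pi_eq_sum_univ' ξ]
  obtain ⟨x, hx, hηx⟩ := hK n (S.image toDiffPolynomial) (toDiffPolynomial η)
    ⟨L, _, _, _, hLK, _, by
      intro f hf
      obtain ⟨ξ, hξ, rfl⟩ := Finset.mem_image.1 hf
      rw [hval, N.mkQ_apply, (Submodule.Quotient.mk_eq_zero N).2 (Submodule.subset_span hξ), map_zero],
      by
      rw [hval, Ne, map_eq_zero_iff j hj]
      exact fun h => hηN ((Submodule.Quotient.mk_eq_zero N).1 h)⟩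
  refine hηx ?_
  rw [value_toDiffPolynomial_self]
  refine hη x fun ξ hξ => ?_
  -- The functions vanishing at `x` form a submodule, so vanishing of the generators in `S`
  -- suffices.
  have hle : N ≤ vanishing m {x} := Submodule.span_le.2 fun ξ hξ y hy => by
    rw [Set.mem_singleton_iff.1 hy, ← value_toDiffPolynomial_self]
    exact hx _ (Finset.mem_image_of_mem _ hξ)
  exact hle hξ x rfl

end LinearDifferential

theorem mainTheorem6 (m n : ℕ) (K : Type*) [Field K] [CharZero K] [CommutingDerivations m K]
    (hK : IsDifferentiallyClosed m K) :
    (∀ N : Submodule (DiffOp m K) (Fin n → DiffOp m K),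
      N = LinearDifferential.vanishing m (LinearDifferential.zeros N)) ∧
    Set.BijOn
      (fun N : Submodule (DiffOp m K) (Fin n → DiffOp m K) => LinearDifferential.zeros N)
      Set.univ {X | LinearDifferential.IsLinearDifferentialSpace m X} ∧
    (∀ X : Set (Fin n → K), LinearDifferential.IsLinearDifferentialSpace m X →
      LinearDifferential.zeros (LinearDifferential.vanishing m X) = X) ∧
    ∀ N N' : Submodule (DiffOp m K) (Fin n → DiffOp m K),
      N ≤ N' ↔ LinearDifferential.zeros N' ⊆ LinearDifferential.zeros N := by
  have key := LinearDifferential.vanishing_zeros (n := n) hK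
  refine ⟨fun N => (key N).symm, ⟨fun N _ => ⟨N, rfl⟩, fun N _ N' _ h => ?_, ?_⟩, ?_, ?_⟩
  · rw [← key N, ← key N']
    exact congrArg _ h
  · rintro X ⟨N, rfl⟩
    exact ⟨N, Set.mem_univ N, rfl⟩
  · rintro X ⟨N, rfl⟩
    rw [key]
  · refine fun N N' => ⟨fun h x hx ξ hξ => hx ξ (h hξ), fun h => ?_⟩
    rw [← key N, ← key N']
    exact fun ξ hξ x hx => hξ x (h hx)
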